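/- **Theorem (uniqueness of the difference solution).** Let $1<\alpha\le 2$, $\upsilon>0$, $\kappa>0$, $\eta,\zeta,\gamma\in\mathbb R$, $a<b$, $T>0$, and let $u_0:\mathbb R\to\mathbb C$ be continuous on $[a,b]$ (for instance smooth). For positive integers $M,N$ put $h=\frac{b-a}{M}$, $\tau=\frac TN$ and $x_j=a+jh$. Let $g_l=(-1)^l\binom{\alpha}{l}$, $$\lambda_1=\tfrac{\alpha^2+3\alpha+2}{12},\quad \lambda_0=\tfrac{4-\alpha^2}{6},\quad \lambda_{-1}=\tfrac{\alpha^2-3\alpha+2}{12},$$ $$w_0=\lambda_1g_0,\quad w_1=\lambda_1g_1+\lambda_0g_0,\quad w_l=\lambda_1g_l+\lambda_0g_{l-1}+\lambda_{-1}g_{l-2}\ (l\ge2),$$ and for a grid function $v=(v_j)_{j\in\mathbb Z}$ with $v_j=0$ for $j\le 0$ and $j\ge M$ let $$\Delta_h^\alpha v_j=\frac{1}{h^\alpha}\,\frac{1}{2\cos\frac{\alpha\pi}{2}}\Big(\sum_{l=0}^{j+1}w_lv_{j-l+1}+\sum_{l=0}^{M-j+1}w_lv_{j+l-1}\Big),\qquad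 1\le j\le M-1.$$ Consider the difference scheme for $u=(u^n_j)$, where $u_j^{n+1/2}=\frac12(u_j^{n+1}+u_j^n)$: $$\frac{u_j^{n+1}-u_j^n}{\tau}+(\upsilon+i\eta)\Delta_h^\alpha u_j^{n+\frac12}+(\kappa+i\zeta)|u_j^{n+\frac12}|^2u_j^{n+\frac12}-\gamma u_j^{n+\frac12}=0,\quad 1\le j\le M-1,\ 0\le n\le N-1,$$ $$u^0_j=u_0(x_j)\ \ (1\le j\le M-1),\qquad u^n_j=0\ \ (j\le 0\text{ or }j\ge M,\ 0\le n\le N).$$ Then for every constant $C>0$ there exist $\tau_0>0$ and $h_0>0$ (depending only on $C$ and on the data $\alpha,\upsilon,\eta,\kappa,\zeta,\gamma,a,b,T,u_0$) such that, whenever $\tau\le Ch$, $0<\tau\le\tau_0$ and $0<h\le h_0$, the solution of the scheme is unique at each time level: if $0\le m\le N$ and two grid functions $u,v$ satisfy the scheme on the time levels $0,\dots,m$, then $u^n_j=v^n_j$ for all $0\le n\le m$ and $j\in\mathbb Z$. -/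

import Mathlib

noncomputable section

namespace FGL

/-- Grünwald coefficients `g_l = (-1)^l (α choose l)`: the power series coefficients of
`(1 - z)^α`. -/
def grunwald (α : ℝ) (l : ℕ) : ℝ := (-1) ^ l * Ring.choose α l

/-- The weight `λ₁`. -/
def lamOne (α : ℝ) : ℝ := (α ^ 2 + 3 * α + 2) / 12

/-- The weight `λ₀`. -/
def lamZero (α : ℝ) : ℝ := (4 - α ^ 2) / 6

/-- The weight `λ₋₁`. -/
def lamNegOne (α : ℝ) : ℝ := (α ^ 2 - 3 * α + 2) / 12

/-- The coefficients `w_l` of the weighted and shifted Grünwald difference (WSGD) operator. -/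
def wsgd (α : ℝ) : ℕ → ℝ
  | 0 => lamOne α * grunwald α 0
  | 1 => lamOne α * grunwald α 1 + lamZero α * grunwald α 0
  | l + 2 => lamOne α * grunwald α (l + 2) + lamZero α * grunwald α (l + 1)
      + lamNegOne α * grunwald α l

/-- The WSGD approximation `Δ_h^α` of the fractional Laplacian `(-Δ)^{α/2}` on a grid with `M`
cells of size `h`, applied to a grid function `v` (which vanishes for `j ≤ 0` and `j ≥ M`):
`1 / (2 cos(απ/2) h^α) * (∑_{l=0}^{j+1} w_l v_{j-l+1} + ∑_{l=0}^{M-j+1} w_l v_{j+l-1})`. -/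
def fracLap (α h : ℝ) (M : ℕ) (v : ℤ → ℂ) (j : ℤ) : ℂ :=
  ((1 / h ^ α * (1 / (2 * Real.cos (α * Real.pi / 2))) : ℝ) : ℂ) *
    (∑ l ∈ Finset.range (j + 2).toNat, (wsgd α l : ℂ) * v (j - l + 1)
      + ∑ l ∈ Finset.range ((M : ℤ) - j + 2).toNat, (wsgd α l : ℂ) * v (j + l - 1))

/-- The grid function `u^{n+1/2} = (u^{n+1} + u^n) / 2`. -/
def midLevel (u : ℕ → ℤ → ℂ) (n : ℕ) (j : ℤ) : ℂ := (u (n + 1) j + u n j) / 2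

/-- `u` (with `u n j` the value at time level `n` and grid point `x_j = a + j h`) satisfies the
implicit midpoint / WSGD difference scheme on the time levels `0, …, m`. The interior indices are
`0 < j < M`. -/
structure IsSchemeSolution (α υ η κ ζ γ a h τ : ℝ) (M : ℕ) (u₀ : ℝ → ℂ) (m : ℕ)
    (u : ℕ → ℤ → ℂ) : Prop where
  scheme : ∀ n : ℕ, n < m → ∀ j : ℤ, 0 < j → j < M →
    (u (n + 1) j - u n j) / (τ : ℂ)
      + ((υ : ℂ) + Complex.I * (η : ℂ)) * fracLap α h M (midLevel u n) j
      + ((κ : ℂ) + Complex.I * (ζ : ℂ)) * ((‖midLevel u n j‖ ^ 2 : ℝ) : ℂ) * midLevel u n j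
      - (γ : ℂ) * midLevel u n j = 0
  initial : ∀ j : ℤ, 0 < j → j < M → u 0 j = u₀ (a + j * h)
  boundary : ∀ n : ℕ, n ≤ m → ∀ j : ℤ, j ≤ 0 ∨ (M : ℤ) ≤ j → u n j = 0

end FGL

end

namespace FGL

/-! Two solutions that agree at level `n` have midpoints differing by some `W`, and their next
levels differ by `2 * W`. Testing the difference of the schemes with `conj W` gives `2/τ` times the
energy of `W` on the left. The fractional term only helps, the linear term costs `γ`, and the cubic
term costs `3 * Z * sup |U|²`, where `Z = |κ + iζ|` and `U` runs over the two midpoints. Hence `W =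
0` once `τ * sup |U|²` and `τ * |γ|` are small (`eq_succ`).

Smallness of `τ * sup |U|²` comes from dissipation in a single step. The sign pattern of the weights
makes the operator coercive: its quadratic form dominates `h^(-α) * incr U 1`. The energy identity,
with `γ` absorbed by `κ > 0`, then gives `τ * incr U 1 ≲ M * h^α ≲ h^(α-1)`. Since `sup |U|² ≤ ε⁻¹ *
incr U 1 + ε * energy U` and `τ ≤ C * h`, it follows that `τ * sup |U|² ≲ ε⁻¹ * h^(α-1) + ε * C`.
This is small for `ε` small and then `h` small, because `α > 1`. -/

/-! ### Signs and partial sums of the weights -/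

theorem grunwald_zero (α : ℝ) : grunwald α 0 = 1 := by
  simp [grunwald]

theorem grunwald_one (α : ℝ) : grunwald α 1 = -α := by
  simp [grunwald]

theorem grunwald_succ (α : ℝ) (k : ℕ) :
    grunwald α (k + 1) = grunwald α k * ((k - α) / (k + 1)) := by
  have h1 : (k + 1 : ℝ) ≠ 0 := by positivity
  have h2 : (k + 1 : ℝ) * Ring.choose α (k + 1) = (α - k) * Ring.choose α k := by
    have h3 := Ring.descPochhammer_eq_factorial_smul_choose α k
    have h4 := Ring.descPochhammer_eq_factorial_smul_choose α (k + 1)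
    rw [descPochhammer_succ_right, Polynomial.smeval_mul, h3] at h4
    have h5 : (k.factorial : ℝ) ≠ 0 := by positivity
    simp only [Polynomial.smeval_sub, Polynomial.smeval_X, Polynomial.smeval_natCast, nsmul_eq_mul,
      pow_one, pow_zero, Nat.factorial_succ, Nat.cast_mul, Nat.cast_add, Nat.cast_one,
      mul_one] at h4
    apply mul_left_cancel₀ h5
    linear_combination -h4
  unfold grunwald
  rw [pow_succ]
  field_simp
  linear_combination -h2

theorem grunwald_two (α : ℝ) : grunwald α 2 = α * (α - 1) / 2 := by
  rw [grunwald_succ, grunwald_one]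
  push_cast
  ring

/-- Pascal's rule; in generating functions, `(1-z)^α / (1-z) = (1-z)^(α-1)`. -/
theorem sum_grunwald (α : ℝ) (n : ℕ) :
    ∑ l ∈ Finset.range (n + 1), grunwald α l = grunwald (α - 1) n := by
  induction n with
  | zero => simp [grunwald_zero]
  | succ n ih =>
    rw [Finset.sum_range_succ, ih]
    have h := Ring.choose_succ_succ (α - 1) n
    rw [sub_add_cancel] at h
    unfold grunwald
    rw [h, pow_succ]
    ring

theorem sum_wsgd (α : ℝ) (n : ℕ) :
    ∑ l ∈ Finset.range (n + 3), wsgd α l =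
      lamOne α * grunwald (α - 1) (n + 2) + lamZero α * grunwald (α - 1) (n + 1)
        + lamNegOne α * grunwald (α - 1) n := by
  rw [← sum_grunwald, ← sum_grunwald, ← sum_grunwald]
  induction n with
  | zero => simp [Finset.sum_range_succ, wsgd]; ring
  | succ n ih =>
    rw [Finset.sum_range_succ, ih, Finset.sum_range_succ _ (n + 1 + 2),
      Finset.sum_range_succ _ (n + 1 + 1), Finset.sum_range_succ _ (n + 1), wsgd]
    ring

theorem grunwald_nonneg {α : ℝ} (h1 : 1 < α) (h2 : α ≤ 2) (k : ℕ) :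
    0 ≤ grunwald α (k + 2) := by
  induction k with
  | zero => rw [zero_add, grunwald_two]; nlinarith
  | succ k ih =>
    rw [grunwald_succ]
    refine mul_nonneg ih (div_nonneg ?_ (by positivity))
    push_cast
    linarith [Nat.cast_nonneg (α := ℝ) k]

theorem grunwald_nonpos {β : ℝ} (h1 : 0 < β) (h2 : β ≤ 1) (k : ℕ) :
    grunwald β (k + 1) ≤ 0 := by
  induction k with
  | zero => rw [zero_add, grunwald_one]; linarith
  | succ k ih =>
    rw [grunwald_succ]
    refine mul_nonpos_of_nonpos_of_nonneg ih (div_nonneg ?_ (by positivity))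
    push_cast
    linarith [Nat.cast_nonneg (α := ℝ) k]

/-- `wsgd α 2` is negative for `α` near 1. Only this sum matters, as both weights multiply the
increment over one cell. -/
theorem wsgd_zero_add_two_pos {α : ℝ} (h1 : 1 < α) (h2 : α ≤ 2) : 0 < wsgd α 0 + wsgd α 2 := by
  simp only [wsgd, grunwald_zero, zero_add, grunwald_one, grunwald_two, lamOne, lamZero, lamNegOne]
  obtain ⟨t, rfl⟩ : ∃ t, α = 1 + t := ⟨α - 1, by ring⟩
  have ht : 0 < t := by linarith
  have : 0 < t * (t ^ 3 + 10 * t ^ 2 + 17 * t + 8) := by positivity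
  nlinarith

/-- From index 4 on, the recurrence pulls out a nonnegative Grünwald coefficient and leaves a
rational factor. Index 3 is separate because it involves `g₁ = -α < 0`. -/
theorem wsgd_nonneg {α : ℝ} (h1 : 1 < α) (h2 : α ≤ 2) (k : ℕ) : 0 ≤ wsgd α (k + 3) := by
  rcases k with _ | k
  · have e : wsgd α 3 = α * ((2 - α) * (α - 1)) * ((α ^ 2 + 3 * α + 2) / 72 + (3 + α) / 12) := by
      have h3 : grunwald α 3 = α * (α - 1) * (2 - α) / 6 := by
        rw [grunwald_succ, grunwald_two]; push_cast; ring
      simp only [wsgd, grunwald_one, grunwald_two, Nat.reduceAdd, h3, lamOne, lamZero,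
        lamNegOne]
      ring
    rw [zero_add, e]
    have : 0 ≤ (2 - α) * (α - 1) := mul_nonneg (by linarith) (by linarith)
    positivity
  · have e : wsgd α (k + 1 + 3) = grunwald α (k + 2) * ((lamOne α * (k + 3 - α) * (k + 2 - α)
        + lamZero α * (k + 4) * (k + 2 - α) + lamNegOne α * (k + 3) * (k + 4))
          / ((k + 3) * (k + 4))) := by
      have h3 : (k : ℝ) + 3 ≠ 0 := by positivity
      have h4 : (k : ℝ) + 4 ≠ 0 := by positivity
      rw [wsgd, grunwald_succ α (k + 1 + 1 + 1), grunwald_succ α (k + 1 + 1)]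
      have h5 : ((k + 1 + 1 : ℕ) : ℝ) + 1 = k + 3 := by push_cast; ring
      have h6 : ((k + 1 + 1 + 1 : ℕ) : ℝ) + 1 = k + 4 := by push_cast; ring
      rw [h5, h6]
      push_cast
      field_simp
      ring
    rw [e]
    refine mul_nonneg (grunwald_nonneg h1 h2 k) (div_nonneg ?_ (by positivity))
    -- In `s = 2 - α` the numerator is a quadratic in `k` with nonnegative coefficients.
    obtain ⟨s, rfl⟩ : ∃ s, α = 2 - s := ⟨2 - α, by ring⟩
    have hk : (0 : ℝ) ≤ k := Nat.cast_nonneg k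
    have hs : 0 ≤ s := by linarith
    have hs1 : s ≤ 1 := by linarith
    have h3 : 0 ≤ 12 + 42 * s - 6 * s ^ 2 := by nlinarith
    have h4 : 0 ≤ k ^ 2 + (12 + 42 * s - 6 * s ^ 2) * k / 12 + (s * (7 - s)) ^ 2 / 12 := by
      positivity
    simp only [lamOne, lamZero, lamNegOne]
    linarith

/-- The same factorization with exponent `α - 1 ∈ (0, 1]`, whose Grünwald coefficients are
nonpositive from index 1 on. The case `n = 0` still contains the positive coefficient of index 0. -/
theorem sum_wsgd_nonpos {α : ℝ} (h1 : 1 < α) (h2 : α ≤ 2) (n : ℕ) :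
    ∑ l ∈ Finset.range (n + 3), wsgd α l ≤ 0 := by
  rw [sum_wsgd]
  rcases n with _ | n
  · simp only [zero_add, grunwald_one, grunwald_two, grunwald_zero, lamOne, lamZero, lamNegOne]
    obtain ⟨t, rfl⟩ : ∃ t, α = 1 + t := ⟨α - 1, by ring⟩
    have ht : 0 ≤ t := by linarith
    have h3 : 0 ≤ t * (1 - t) := mul_nonneg ht (by linarith)
    have h4 : 0 ≤ t * (1 - t) * (t ^ 2 + 5 * t + 7) := by positivity
    have h5 : 0 ≤ t * ((1 - t) * (3 + t)) :=
      mul_nonneg ht (mul_nonneg (by linarith) (by linarith))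
    linarith
  · have e : lamOne α * grunwald (α - 1) (n + 1 + 2) + lamZero α * grunwald (α - 1) (n + 1 + 1)
        + lamNegOne α * grunwald (α - 1) (n + 1) = grunwald (α - 1) (n + 1) *
        ((lamOne α * (n + 3 - α) * (n + 2 - α)
        + lamZero α * (n + 3) * (n + 2 - α) + lamNegOne α * (n + 2) * (n + 3))
          / ((n + 2) * (n + 3))) := by
      have h3 : (n : ℝ) + 2 ≠ 0 := by positivity
      have h4 : (n : ℝ) + 3 ≠ 0 := by positivity
      rw [grunwald_succ _ (n + 1 + 1), grunwald_succ _ (n + 1)]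
      have h5 : ((n + 1 : ℕ) : ℝ) + 1 = n + 2 := by push_cast; ring
      have h6 : ((n + 1 + 1 : ℕ) : ℝ) + 1 = n + 3 := by push_cast; ring
      rw [h5, h6]
      push_cast
      field_simp
      ring
    rw [e]
    refine mul_nonpos_of_nonpos_of_nonneg
      (grunwald_nonpos (by linarith) (by linarith) n) (div_nonneg ?_ (by positivity))
    obtain ⟨s, rfl⟩ : ∃ s, α = 2 - s := ⟨2 - α, by ring⟩
    have hn : (0 : ℝ) ≤ n := Nat.cast_nonneg n
    have hs : 0 ≤ s := by linarith
    have h3 : 0 ≤ 12 + 36 * s - 6 * s ^ 2 := by nlinarith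
    have h4 : 0 ≤ 6 + 35 * s - 12 * s ^ 2 + s ^ 3 := by nlinarith [pow_nonneg hs 3]
    have h5 : 0 ≤ (n : ℝ) ^ 2 + (12 + 36 * s - 6 * s ^ 2) * n / 12
        + s * (6 + 35 * s - 12 * s ^ 2 + s ^ 3) / 12 := by positivity
    simp only [lamOne, lamZero, lamNegOne]
    linarith

/-! ### Quadratic form of the operator and its coercivity -/

open ComplexConjugate

/-- A grid function on a grid with `M` cells that vanishes at the boundary and outside. -/
def IsGridFun (M : ℕ) (v : ℤ → ℂ) : Prop := ∀ j : ℤ, j ≤ 0 ∨ (M : ℤ) ≤ j → v j = 0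

theorem IsGridFun.summable {M : ℕ} {v : ℤ → ℂ} (hv : IsGridFun M v) {E : Type*}
    [NormedAddCommGroup E] {f : ℤ → E} (hf : ∀ j, v j = 0 → f j = 0) : Summable f := by
  refine summable_of_ne_finset_zero (s := Finset.Ioo (0 : ℤ) M) fun j hj => hf j (hv j ?_)
  rw [Finset.mem_Ioo] at hj
  omega

theorem IsGridFun.tsum_eq {M : ℕ} {v : ℤ → ℂ} (hv : IsGridFun M v) {E : Type*}
    [NormedAddCommGroup E] {f : ℤ → E} (hf : ∀ j, v j = 0 → f j = 0) :
    ∑' j, f j = ∑ j ∈ Finset.Ioo (0 : ℤ) M, f j := by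
  refine tsum_eq_sum fun j hj => hf j (hv j ?_)
  rw [Finset.mem_Ioo] at hj
  omega

/-- The autocorrelation of a grid function. -/
noncomputable def corr (v : ℤ → ℂ) (k : ℤ) : ℂ := ∑' j, conj (v j) * v (j + k)

/-- The sum of the squared moduli of a grid function. -/
noncomputable def energy (v : ℤ → ℂ) : ℝ := ∑' j, ‖v j‖ ^ 2

/-- The sum of the squared moduli of the increments of a grid function over `k` cells. -/
noncomputable def incr (v : ℤ → ℂ) (k : ℤ) : ℝ := ∑' j, ‖v (j + k) - v j‖ ^ 2

theorem energy_nonneg (v : ℤ → ℂ) : 0 ≤ energy v := tsum_nonneg fun _ => by positivity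

theorem incr_nonneg (v : ℤ → ℂ) (k : ℤ) : 0 ≤ incr v k := tsum_nonneg fun _ => by positivity

theorem incr_zero (v : ℤ → ℂ) : incr v 0 = 0 := by simp [incr]

theorem tsum_shift {E : Type*} [NormedAddCommGroup E] (f : ℤ → E) (k : ℤ) :
    ∑' j, f (j + k) = ∑' j, f j := (Equiv.addRight k).tsum_eq f

theorem summable_shift {E : Type*} [NormedAddCommGroup E] {f : ℤ → E} (hf : Summable f) (k : ℤ) :
    Summable fun j => f (j + k) := (Equiv.addRight k).summable_iff.mpr hf

theorem incr_neg (v : ℤ → ℂ) (k : ℤ) : incr v (-k) = incr v k := by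
  unfold incr
  rw [← tsum_shift _ k]
  simp [norm_sub_rev]

theorem corr_neg (v : ℤ → ℂ) (k : ℤ) : corr v (-k) = conj (corr v k) := by
  unfold corr
  rw [← tsum_shift _ k, Complex.conj_tsum]
  simp [mul_comm]

section GridFun

variable {M : ℕ} {v : ℤ → ℂ}

theorem summable_energy (hv : IsGridFun M v) : Summable fun j => ‖v j‖ ^ 2 :=
  hv.summable fun j h => by simp [h]

theorem summable_corr (hv : IsGridFun M v) (k : ℤ) : Summable fun j => conj (v j) * v (j + k) :=
  hv.summable fun j h => by simp [h]

theorem norm_sub_sq_eq (a b : ℂ) : ‖a - b‖ ^ 2 = ‖a‖ ^ 2 + ‖b‖ ^ 2 - 2 * (conj b * a).re := by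
  simp only [← Complex.normSq_eq_norm_sq, Complex.normSq_apply, Complex.sub_re, Complex.sub_im,
    Complex.mul_re, Complex.conj_re, Complex.conj_im]
  ring

theorem hasSum_incr (hv : IsGridFun M v) (k : ℤ) :
    HasSum (fun j => ‖v (j + k) - v j‖ ^ 2) (energy v + energy v - 2 * (corr v k).re) := by
  simp only [norm_sub_sq_eq]
  have h1 : HasSum (fun j => ‖v (j + k)‖ ^ 2) (energy v) :=
    (Equiv.addRight k).hasSum_iff.mpr (summable_energy hv).hasSum
  have h2 := Complex.hasSum_re (summable_corr hv k).hasSum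
  exact (h1.add (summable_energy hv).hasSum).sub (h2.mul_left 2)

theorem two_mul_re_corr (hv : IsGridFun M v) (k : ℤ) :
    2 * (corr v k).re = 2 * energy v - incr v k := by
  rw [incr, (hasSum_incr hv k).tsum_eq]
  ring

/-- The two one-sided sums carry opposite shifts with equal weights, so their correlations are
conjugate and the quadratic form is real. -/
theorem corr_add_corr_neg (hv : IsGridFun M v) (k : ℤ) :
    corr v (-k) + corr v k = ((2 * energy v - incr v k : ℝ) : ℂ) := by
  rw [corr_neg, add_comm, Complex.add_conj, two_mul_re_corr hv]

theorem fracLap_eq (hv : IsGridFun M v) (α h : ℝ) {j : ℤ} (h0 : 0 < j) (hM : j < M) :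
    fracLap α h M v j = ((1 / h ^ α * (1 / (2 * Real.cos (α * Real.pi / 2))) : ℝ) : ℂ) *
      ∑ l ∈ Finset.range (M + 2),
        (wsgd α l : ℂ) * (v (j + -((l : ℤ) - 1)) + v (j + ((l : ℤ) - 1))) := by
  unfold fracLap
  simp only [mul_add, Finset.sum_add_distrib]
  congr 2
  · have e : ∀ l : ℕ, j + -((l : ℤ) - 1) = j - l + 1 := fun l => by ring
    simp only [e]
    refine Finset.sum_subset (fun l hl => ?_) fun l _ hl => ?_
    · rw [Finset.mem_range] at *
      omega
    · rw [Finset.mem_range] at hl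
      rw [hv _ (by omega), mul_zero]
  · simp only [add_sub_assoc]
    refine Finset.sum_subset (fun l hl => ?_) fun l _ hl => ?_
    · rw [Finset.mem_range] at *
      omega
    · rw [Finset.mem_range] at hl
      rw [hv _ (by omega), mul_zero]

theorem tsum_conj_mul_fracLap (hv : IsGridFun M v) (α h : ℝ) :
    ∑' j, conj (v j) * fracLap α h M v j =
      ((1 / h ^ α * (1 / (2 * Real.cos (α * Real.pi / 2))) *
        ∑ l ∈ Finset.range (M + 2), wsgd α l * (2 * energy v - incr v ((l : ℤ) - 1)) : ℝ) : ℂ) := by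
  have e : ∀ j, conj (v j) * fracLap α h M v j =
      ((1 / h ^ α * (1 / (2 * Real.cos (α * Real.pi / 2))) : ℝ) : ℂ) *
      ∑ l ∈ Finset.range (M + 2), (wsgd α l : ℂ) *
        (conj (v j) * v (j + -((l : ℤ) - 1)) + conj (v j) * v (j + ((l : ℤ) - 1))) := by
    intro j
    -- Outside the interior the factor `conj (v j)` vanishes, whatever `fracLap` gives there.
    by_cases hj : 0 < j ∧ j < M
    · rw [fracLap_eq hv α h hj.1 hj.2, mul_left_comm, Finset.mul_sum]
      congr 1
      exact Finset.sum_congr rfl fun l _ => by ring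
    · have : v j = 0 := hv j (by omega)
      simp [this]
  have hs : ∀ k : ℤ, Summable fun j =>
      conj (v j) * v (j + -k) + conj (v j) * v (j + k) := fun k =>
    (summable_corr hv (-k)).add (summable_corr hv k)
  simp only [e]
  rw [tsum_mul_left, Summable.tsum_finsetSum fun l _ => (hs _).mul_left _, Complex.ofReal_mul _ (∑ l ∈ _, _),
    Complex.ofReal_sum]
  congr 1
  refine Finset.sum_congr rfl fun l _ => ?_
  rw [tsum_mul_left, Complex.ofReal_mul, ← corr_add_corr_neg hv,
    (summable_corr hv _).tsum_add (summable_corr hv _)]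
  rfl

/-- The energy is multiplied by a nonpositive partial sum. Among the increments, `l = 1` drops out
as `incr v 0 = 0`, `l = 0` and `l = 2` both give `incr v 1`, and the rest have nonnegative weights.
-/
theorem sum_wsgd_mul_le {α : ℝ} (h1 : 1 < α) (h2 : α ≤ 2) (hM : 0 < M) :
    ∑ l ∈ Finset.range (M + 2), wsgd α l * (2 * energy v - incr v ((l : ℤ) - 1)) ≤
      -((wsgd α 0 + wsgd α 2) * incr v 1) := by
  obtain ⟨n, rfl⟩ : ∃ n, M = n + 1 := ⟨M - 1, by omega⟩
  simp only [mul_sub, Finset.sum_sub_distrib, ← Finset.sum_mul]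
  have h3 := mul_nonpos_of_nonpos_of_nonneg (sum_wsgd_nonpos h1 h2 n)
    (mul_nonneg zero_le_two (energy_nonneg v))
  have h4 : (wsgd α 0 + wsgd α 2) * incr v 1 ≤
      ∑ l ∈ Finset.range (n + 3), wsgd α l * incr v ((l : ℤ) - 1) := by
    rw [add_comm n 3, Finset.sum_range_add]
    have h5 : 0 ≤ ∑ l ∈ Finset.range n, wsgd α (3 + l) * incr v (((3 + l : ℕ) : ℤ) - 1) :=
      Finset.sum_nonneg fun l _ =>
        mul_nonneg (add_comm 3 l ▸ wsgd_nonneg h1 h2 l) (incr_nonneg _ _)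
    have h6 : ∑ l ∈ Finset.range 3, wsgd α l * incr v ((l : ℤ) - 1) =
        (wsgd α 0 + wsgd α 2) * incr v 1 := by
      simp [Finset.sum_range_succ, incr_neg, incr_zero]
      ring
    linarith
  linarith

/-- The ellipticity constant of the WSGD operator relative to the discrete Laplacian. -/
noncomputable def ellip (α : ℝ) : ℝ := -((wsgd α 0 + wsgd α 2) * (1 / (2 * Real.cos (α * Real.pi / 2))))

theorem cos_neg {α : ℝ} (h1 : 1 < α) (h2 : α ≤ 2) : Real.cos (α * Real.pi / 2) < 0 :=
  Real.cos_neg_of_pi_div_two_lt_of_lt (by nlinarith [Real.pi_pos]) (by nlinarith [Real.pi_pos])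

theorem ellip_pos {α : ℝ} (h1 : 1 < α) (h2 : α ≤ 2) : 0 < ellip α :=
  neg_pos.mpr (mul_neg_of_pos_of_neg (wsgd_zero_add_two_pos h1 h2)
    (one_div_neg.mpr (by linarith [cos_neg h1 h2])))

/-- The WSGD operator is symmetric and bounded below by the discrete Laplacian. -/
theorem exists_tsum_conj_mul_fracLap (hv : IsGridFun M v) {α h : ℝ} (h1 : 1 < α) (h2 : α ≤ 2)
    (hM : 0 < M) (hh : 0 < h) :
    ∃ q : ℝ, ∑' j, conj (v j) * fracLap α h M v j = q ∧ 1 / h ^ α * ellip α * incr v 1 ≤ q := by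
  refine ⟨_, tsum_conj_mul_fracLap hv α h, ?_⟩
  have h3 : 1 / (2 * Real.cos (α * Real.pi / 2)) < 0 :=
    one_div_neg.mpr (by linarith [cos_neg h1 h2])
  have h4 : 0 < 1 / h ^ α := one_div_pos.mpr (Real.rpow_pos_of_pos hh _)
  have h5 := mul_le_mul_of_nonpos_left (sum_wsgd_mul_le (v := v) h1 h2 hM)
    (mul_neg_of_pos_of_neg h4 h3).le
  refine le_trans (le_of_eq ?_) h5
  unfold ellip
  ring

/-- The discrete Gagliardo–Nirenberg inequality, in additive form. -/
theorem norm_sq_le_incr_add_energy (hv : IsGridFun M v) {ε : ℝ} (hε : 0 < ε) (k : ℤ) :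
    ‖v k‖ ^ 2 ≤ ε⁻¹ * incr v 1 + ε * energy v := by
  have hs := (hasSum_incr hv 1).summable
  have he := summable_energy hv
  have he' : Summable fun j => ‖v (j + 1)‖ ^ 2 := summable_shift he 1
  set f : ℤ → ℝ := fun j => ε⁻¹ * ‖v (j + 1) - v j‖ ^ 2
    + ε / 2 * (‖v (j + 1)‖ ^ 2 + ‖v j‖ ^ 2) with hf
  have hfs : Summable f := (hs.mul_left _).add ((he'.add he).mul_left _)
  have hft : ∑' j, f j = ε⁻¹ * incr v 1 + ε * energy v := by
    rw [hf, (hs.mul_left _).tsum_add ((he'.add he).mul_left _), tsum_mul_left, tsum_mul_left,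
      he'.tsum_add he, tsum_shift (fun j => ‖v j‖ ^ 2) 1]
    unfold incr energy
    ring
  have hf0 : ∀ j, 0 ≤ f j := fun j => by positivity
  have step : ∀ j, ‖v j‖ ^ 2 ≤ ‖v (j + 1)‖ ^ 2 + f j := by
    intro j
    have h1 : ‖v j‖ ≤ ‖v (j + 1)‖ + ‖v (j + 1) - v j‖ := by
      have := norm_sub_le (v (j + 1)) (v (j + 1) - v j)
      rwa [sub_sub_cancel] at this
    have h2 : ∀ a b d : ℝ, 0 ≤ a → 0 ≤ b → 0 ≤ d → a ≤ b + d →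
        a ^ 2 ≤ b ^ 2 + (ε⁻¹ * d ^ 2 + ε / 2 * (b ^ 2 + a ^ 2)) := by
      -- Young's inequality for `d * (a + b)`, then `(a + b)² ≤ 2 * (a² + b²)`.
      intro a b d ha hb hd h
      have h3 : a ^ 2 - b ^ 2 ≤ d * (a + b) := by nlinarith
      have h4 : d * (a + b) ≤ ε⁻¹ * d ^ 2 + ε / 4 * (a + b) ^ 2 := by
        have : ε⁻¹ * d ^ 2 + ε / 4 * (a + b) ^ 2 - d * (a + b)
            = ε⁻¹ * (d - ε / 2 * (a + b)) ^ 2 := by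
          field_simp
          ring
        have : 0 ≤ ε⁻¹ * (d - ε / 2 * (a + b)) ^ 2 := by positivity
        linarith
      have h5 : 0 ≤ ε * (a - b) ^ 2 := by positivity
      linarith
    exact h2 _ _ _ (norm_nonneg _) (norm_nonneg _) (norm_nonneg _) h1
  have tele : ∀ n : ℕ, ‖v k‖ ^ 2 ≤ ‖v (k + n)‖ ^ 2 + ∑ i ∈ Finset.range n, f (k + i) := by
    intro n
    induction n with
    | zero => simp
    | succ n ih =>
      rw [Finset.sum_range_succ]
      have := step (k + n)
      rw [Nat.cast_succ, ← add_assoc k]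
      linarith
  -- Telescoping stops at or beyond the right boundary, where `v` vanishes.
  have hz : v (k + ((M - k).toNat : ℕ)) = 0 := hv _ (Or.inr (by omega))
  have h1 := tele (M - k).toNat
  rw [hz, norm_zero, zero_pow two_ne_zero, zero_add] at h1
  refine h1.trans (hft ▸ ?_)
  have hinj : Function.Injective fun i : ℕ => k + (i : ℤ) := fun a b h => by simpa using h
  have h2 := hfs.sum_le_tsum ((Finset.range (M - k).toNat).map ⟨_, hinj⟩) fun j _ => hf0 j
  rwa [Finset.sum_map] at h2

end GridFun

theorem IsGridFun.energy_eq {M : ℕ} {v : ℤ → ℂ} (hv : IsGridFun M v) :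
    energy v = ∑ j ∈ Finset.Ioo (0 : ℤ) M, ‖v j‖ ^ 2 := hv.tsum_eq fun j h => by simp [h]

theorem IsGridFun.eq_zero_of_energy_nonpos {M : ℕ} {v : ℤ → ℂ} (hv : IsGridFun M v)
    (h : energy v ≤ 0) : v = 0 := by
  funext j
  have h1 := (summable_energy hv).le_tsum j fun i _ => sq_nonneg ‖v i‖
  have h2 : ‖v j‖ ^ 2 ≤ 0 := h1.trans h
  simpa using le_antisymm h2 (sq_nonneg _)

/-- The quadratic form is real, so `η` does not contribute to the real part. -/
theorem le_sum_re_fracLap {M : ℕ} {v : ℤ → ℂ} (hv : IsGridFun M v) {α h υ : ℝ} (h1 : 1 < α)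
    (h2 : α ≤ 2) (hM : 0 < M) (hh : 0 < h) (hυ : 0 < υ) (η : ℝ) :
    υ * (1 / h ^ α * ellip α * incr v 1) ≤ ∑ j ∈ Finset.Ioo (0 : ℤ) M,
      (((υ : ℂ) + Complex.I * (η : ℂ)) * (conj (v j) * fracLap α h M v j)).re := by
  obtain ⟨q, hq, hle⟩ := exists_tsum_conj_mul_fracLap hv h1 h2 hM hh
  rw [hv.tsum_eq fun j h => by simp [h]] at hq
  rw [← Complex.re_sum, ← Finset.mul_sum, hq]
  simpa using mul_le_mul_of_nonneg_left hle hυ.le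

theorem fracLap_sub (α h : ℝ) (M : ℕ) (v w : ℤ → ℂ) (j : ℤ) :
    fracLap α h M (v - w) j = fracLap α h M v j - fracLap α h M w j := by
  simp only [fracLap, Pi.sub_apply, mul_sub, Finset.sum_sub_distrib]
  ring

theorem norm_cubic_sub_le {x y : ℂ} {B : ℝ} (hx : ‖x‖ ^ 2 ≤ B) (hy : ‖y‖ ^ 2 ≤ B) :
    ‖((‖x‖ ^ 2 : ℝ) : ℂ) * x - ((‖y‖ ^ 2 : ℝ) : ℂ) * y‖ ≤ 3 * B * ‖x - y‖ := by
  have e : ((‖x‖ ^ 2 : ℝ) : ℂ) * x - ((‖y‖ ^ 2 : ℝ) : ℂ) * y =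
      ((‖x‖ ^ 2 : ℝ) : ℂ) * (x - y) + ((‖x‖ ^ 2 - ‖y‖ ^ 2 : ℝ) : ℂ) * y := by
    push_cast
    ring
  rw [e]
  refine (norm_add_le _ _).trans ?_
  rw [norm_mul, norm_mul, Complex.norm_real, Complex.norm_real, Real.norm_eq_abs, Real.norm_eq_abs,
    abs_of_nonneg (sq_nonneg _), sq_sub_sq, abs_mul, abs_of_nonneg (by positivity)]
  have h1 := abs_norm_sub_norm_le x y
  have hB : 0 ≤ B := (sq_nonneg _).trans hx
  have h2 : (‖x‖ + ‖y‖) * ‖y‖ ≤ 2 * B := by nlinarith [sq_nonneg (‖x‖ - ‖y‖)]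
  calc ‖x‖ ^ 2 * ‖x - y‖ + (‖x‖ + ‖y‖) * |‖x‖ - ‖y‖| * ‖y‖
      = ‖x‖ ^ 2 * ‖x - y‖ + ((‖x‖ + ‖y‖) * ‖y‖) * |‖x‖ - ‖y‖| := by ring
    _ ≤ B * ‖x - y‖ + 2 * B * ‖x - y‖ := by gcongr
    _ = 3 * B * ‖x - y‖ := by ring

/-! ### A priori bounds and uniqueness over one step -/

section Scheme

variable {α υ η κ ζ γ a b h τ : ℝ} {M m : ℕ} {u₀ : ℝ → ℂ} {u v : ℕ → ℤ → ℂ}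

theorem IsSchemeSolution.isGridFun (hu : IsSchemeSolution α υ η κ ζ γ a h τ M u₀ m u) {n : ℕ}
    (hn : n ≤ m) : IsGridFun M (u n) := hu.boundary n hn

theorem IsSchemeSolution.isGridFun_midLevel (hu : IsSchemeSolution α υ η κ ζ γ a h τ M u₀ m u)
    {n : ℕ} (hn : n < m) : IsGridFun M (midLevel u n) := fun j hj => by
  simp [midLevel, hu.boundary n hn.le j hj, hu.boundary (n + 1) hn j hj]

theorem re_conj_midLevel_mul (u : ℕ → ℤ → ℂ) (n : ℕ) (j : ℤ) (τ : ℝ) :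
    (conj (midLevel u n j) * ((u (n + 1) j - u n j) / (τ : ℂ))).re =
      (‖u (n + 1) j‖ ^ 2 - ‖u n j‖ ^ 2) / (2 * τ) := by
  rw [← mul_div_assoc, Complex.div_ofReal_re]
  simp only [midLevel, ← Complex.normSq_eq_norm_sq, Complex.normSq_apply, Complex.mul_re,
    Complex.conj_re, Complex.conj_im, Complex.sub_re, Complex.sub_im, Complex.div_ofNat_re,
    Complex.div_ofNat_im, Complex.add_re, Complex.add_im]
  rw [mul_comm 2 τ, ← div_div, div_div _ τ 2, mul_comm τ 2, ← div_div]
  ring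

/-- Real part of the scheme tested with `conj U`, `U` the midpoint. Completing the square in `κ|U|⁴
- γ|U|²` costs at most `γ²/(4κ)` per node, so growth is linear in time and no Grönwall argument is
needed. -/
theorem IsSchemeSolution.energy_step (hu : IsSchemeSolution α υ η κ ζ γ a h τ M u₀ m u)
    (h1 : 1 < α) (h2 : α ≤ 2) (hυ : 0 < υ) (hκ : 0 < κ) (hM : 0 < M) (hh : 0 < h) (hτ : 0 < τ)
    {n : ℕ} (hn : n < m) :
    energy (u (n + 1)) + 2 * τ * (υ * (1 / h ^ α * ellip α * incr (midLevel u n) 1)) ≤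
      energy (u n) + M * (τ * (γ ^ 2 / (2 * κ))) := by
  have hU := hu.isGridFun_midLevel hn
  have hQ := le_sum_re_fracLap hU h1 h2 hM hh hυ η
  have hpt : ∀ j ∈ Finset.Ioo (0 : ℤ) M, (‖u (n + 1) j‖ ^ 2 - ‖u n j‖ ^ 2) / (2 * τ)
      + (((υ : ℂ) + Complex.I * (η : ℂ)) *
        (conj (midLevel u n j) * fracLap α h M (midLevel u n) j)).re ≤ γ ^ 2 / (4 * κ) := by
    intro j hj
    rw [Finset.mem_Ioo] at hj
    have e := hu.scheme n hn j hj.1 hj.2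
    set U := midLevel u n j with hUdef
    have e1 : conj U * ((u (n + 1) j - u n j) / (τ : ℂ))
        + ((υ : ℂ) + Complex.I * (η : ℂ)) * (conj U * fracLap α h M (midLevel u n) j)
        + ((κ : ℂ) + Complex.I * (ζ : ℂ)) * ((‖U‖ ^ 2 : ℝ) : ℂ) * (conj U * U)
        - (γ : ℂ) * (conj U * U) = 0 := by
      linear_combination (conj U) * e
    rw [mul_comm (conj U) U, Complex.mul_conj, Complex.normSq_eq_norm_sq] at e1
    have e2 := congrArg Complex.re e1
    rw [Complex.sub_re, Complex.add_re, Complex.add_re, hUdef, re_conj_midLevel_mul, ← hUdef,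
      mul_assoc (_ + _), ← Complex.ofReal_mul, ← Complex.ofReal_mul, Complex.re_mul_ofReal,
      Complex.ofReal_re, Complex.zero_re] at e2
    simp only [Complex.add_re, Complex.ofReal_re, Complex.I_mul_re, Complex.ofReal_im, neg_zero,
      add_zero] at e2
    have e3 : 0 ≤ κ * (‖U‖ ^ 2 * ‖U‖ ^ 2) - γ * ‖U‖ ^ 2 + γ ^ 2 / (4 * κ) := by
      have : κ * (‖U‖ ^ 2 * ‖U‖ ^ 2) - γ * ‖U‖ ^ 2 + γ ^ 2 / (4 * κ) =
          (2 * κ * ‖U‖ ^ 2 - γ) ^ 2 / (4 * κ) := by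
        field_simp
        ring
      rw [this]
      positivity
    linarith
  have hsum := Finset.sum_le_sum hpt
  rw [Finset.sum_add_distrib, ← Finset.sum_div, Finset.sum_sub_distrib,
    ← (hu.isGridFun hn).energy_eq, ← (hu.isGridFun hn.le).energy_eq, Finset.sum_const,
    nsmul_eq_mul, Int.card_Ioo] at hsum
  have hcard : (((M : ℤ) - 0 - 1).toNat : ℝ) ≤ M := by
    exact_mod_cast (by omega : ((M : ℤ) - 0 - 1).toNat ≤ M)
  have hc := mul_le_mul_of_nonneg_right hcard (by positivity : 0 ≤ γ ^ 2 / (4 * κ))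
  have hfin : (energy (u (n + 1)) - energy (u n)) / (2 * τ)
      + υ * (1 / h ^ α * ellip α * incr (midLevel u n) 1) ≤ M * (γ ^ 2 / (4 * κ)) := by
    linarith
  have hfin2 := mul_le_mul_of_nonneg_left hfin (by positivity : 0 ≤ 2 * τ)
  rw [mul_add, mul_div_cancel₀ _ (by positivity)] at hfin2
  have : 2 * τ * (M * (γ ^ 2 / (4 * κ))) = M * (τ * (γ ^ 2 / (2 * κ))) := by
    field_simp
    ring
  linarith

theorem IsSchemeSolution.energy_le (hu : IsSchemeSolution α υ η κ ζ γ a h τ M u₀ m u)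
    (h1 : 1 < α) (h2 : α ≤ 2) (hυ : 0 < υ) (hκ : 0 < κ) (hM : 0 < M) (hh : 0 < h) (hτ : 0 < τ)
    {B : ℝ} (hB : ∀ x ∈ Set.Icc a (a + M * h), ‖u₀ x‖ ≤ B) {n : ℕ} (hn : n ≤ m) :
    energy (u n) ≤ M * (B ^ 2 + n * τ * (γ ^ 2 / (2 * κ))) := by
  induction n with
  | zero =>
    rw [(hu.isGridFun hn).energy_eq]
    have hpt : ∀ j ∈ Finset.Ioo (0 : ℤ) M, ‖u 0 j‖ ^ 2 ≤ B ^ 2 := by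
      intro j hj
      rw [Finset.mem_Ioo] at hj
      rw [hu.initial j hj.1 hj.2]
      have hj0 : (0 : ℝ) ≤ j := by exact_mod_cast hj.1.le
      have hjM : (j : ℝ) ≤ M := by exact_mod_cast hj.2.le
      have := hB (a + j * h) ⟨by nlinarith, by nlinarith⟩
      gcongr
    refine (Finset.sum_le_card_nsmul _ _ _ hpt).trans ?_
    rw [nsmul_eq_mul, Int.card_Ioo]
    simp only [Nat.cast_zero, zero_mul, add_zero]
    gcongr
    omega
  | succ n ih =>
    have h3 := hu.energy_step h1 h2 hυ hκ hM hh hτ hn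
    have h4 := ih (Nat.le_of_succ_le hn)
    have h5 : 0 ≤ 2 * τ * (υ * (1 / h ^ α * ellip α * incr (midLevel u n) 1)) := by
      have := ellip_pos h1 h2
      have := incr_nonneg (midLevel u n) 1
      positivity
    push_cast
    linarith

theorem IsSchemeSolution.energy_midLevel_le (hu : IsSchemeSolution α υ η κ ζ γ a h τ M u₀ m u)
    {n : ℕ} (hn : n < m) {K : ℝ} (h0 : energy (u n) ≤ K) (h1 : energy (u (n + 1)) ≤ K) :
    energy (midLevel u n) ≤ K := by
  have hpt : ∀ j ∈ Finset.Ioo (0 : ℤ) M, ‖midLevel u n j‖ ^ 2 ≤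
      (‖u (n + 1) j‖ ^ 2 + ‖u n j‖ ^ 2) / 2 := by
    intro j _
    rw [midLevel, norm_div, div_pow]
    have h3 := norm_add_le (u (n + 1) j) (u n j)
    have h4 : ‖u (n + 1) j + u n j‖ ^ 2 ≤ (‖u (n + 1) j‖ + ‖u n j‖) ^ 2 := by gcongr
    norm_num
    nlinarith [sq_nonneg (‖u (n + 1) j‖ - ‖u n j‖)]
  have := Finset.sum_le_sum hpt
  rw [← Finset.sum_div, Finset.sum_add_distrib, ← (hu.isGridFun hn).energy_eq,
    ← (hu.isGridFun hn.le).energy_eq, ← (hu.isGridFun_midLevel hn).energy_eq] at this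
  linarith

/-- Energy dissipation bounds the midpoint values by `o(τ^{-1/2})`. -/
theorem IsSchemeSolution.mul_norm_midLevel_sq_le
    (hu : IsSchemeSolution α υ η κ ζ γ a h τ M u₀ m u)
    (h1 : 1 < α) (h2 : α ≤ 2) (hυ : 0 < υ) (hκ : 0 < κ) (hM : 0 < M) (hh : 0 < h) (hτ : 0 < τ)
    {B T C ε : ℝ} (hB : ∀ x ∈ Set.Icc a (a + M * h), ‖u₀ x‖ ≤ B) (hT : m * τ ≤ T)
    (hC : τ ≤ C * h) (hε : 0 < ε) {n : ℕ} (hn : n < m) (k : ℤ) :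
    τ * ‖midLevel u n k‖ ^ 2 ≤ (M * h) * (B ^ 2 + T * (γ ^ 2 / (2 * κ))) *
      (ε⁻¹ * (h ^ (α - 1) / (2 * υ * ellip α)) + ε * C) := by
  set K := B ^ 2 + T * (γ ^ 2 / (2 * κ)) with hK
  have hel := ellip_pos h1 h2
  have hR : 0 ≤ γ ^ 2 / (2 * κ) := by positivity
  have hle : ∀ l : ℕ, l ≤ m → M * (B ^ 2 + l * τ * (γ ^ 2 / (2 * κ))) ≤ M * K := by
    intro l hl
    have hl' : (l : ℝ) ≤ m := by exact_mod_cast hl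
    have : l * τ ≤ T := le_trans (by gcongr) hT
    rw [hK]
    gcongr
  have hE := hu.energy_le h1 h2 hυ hκ hM hh hτ hB (n := n) hn.le
  have hE1 := hu.energy_le h1 h2 hυ hκ hM hh hτ hB (n := n + 1) hn
  have hm := hu.energy_midLevel_le hn (hE.trans (hle _ hn.le)) (hE1.trans (hle _ hn))
  have hst := hu.energy_step h1 h2 hυ hκ hM hh hτ hn
  have hK0 : 0 ≤ M * K := (energy_nonneg _).trans (hE.trans (hle _ hn.le))
  -- The dissipation of one step is at most the whole energy budget.
  have hD : 2 * τ * (υ * (1 / h ^ α * ellip α * incr (midLevel u n) 1)) ≤ M * K := by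
    have h3 := hle (n + 1) hn
    push_cast at h3
    linarith [energy_nonneg (u (n + 1))]
  have hha : 0 < h ^ α := Real.rpow_pos_of_pos hh _
  have hD2 : τ * incr (midLevel u n) 1 ≤ M * K * (h ^ α / (2 * υ * ellip α)) := by
    have := mul_le_mul_of_nonneg_right hD (by positivity : 0 ≤ h ^ α / (2 * υ * ellip α))
    refine le_trans (le_of_eq ?_) this
    field_simp
  -- One factor `h` compensates the `M` of the unscaled energy; the other, `h ^ (α - 1)`, still
  -- tends to 0.
  have hpow : h ^ α = h * h ^ (α - 1) := by
    rw [Real.rpow_sub_one hh.ne']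
    field_simp
  rw [hpow] at hD2
  have hs := mul_le_mul_of_nonneg_left
    (norm_sq_le_incr_add_energy (hu.isGridFun_midLevel hn) hε k) hτ.le
  calc τ * ‖midLevel u n k‖ ^ 2
      ≤ ε⁻¹ * (τ * incr (midLevel u n) 1) + ε * (τ * energy (midLevel u n)) := by linarith
    _ ≤ ε⁻¹ * (M * K * (h * h ^ (α - 1) / (2 * υ * ellip α))) + ε * ((C * h) * (M * K)) := by
        have := energy_nonneg (midLevel u n)
        have hCh : 0 ≤ C * h := hτ.le.trans hC
        gcongr
    _ = _ := by ring

/-- Two solutions that agree at one time level, and whose midpoint values are small relative to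
`τ^{-1/2}`, agree at the next time level. -/
theorem IsSchemeSolution.eq_succ (hu : IsSchemeSolution α υ η κ ζ γ a h τ M u₀ m u)
    (hv : IsSchemeSolution α υ η κ ζ γ a h τ M u₀ m v)
    (h1 : 1 < α) (h2 : α ≤ 2) (hυ : 0 < υ) (hM : 0 < M) (hh : 0 < h) (hτ : 0 < τ)
    {δ : ℝ} (hδ : 3 * ‖(κ : ℂ) + Complex.I * (ζ : ℂ)‖ * δ < 1) (hγ : τ * |γ| ≤ 1)
    {n : ℕ} (hn : n < m) (huv : u n = v n)
    (hU : ∀ k, τ * ‖midLevel u n k‖ ^ 2 ≤ δ) (hV : ∀ k, τ * ‖midLevel v n k‖ ^ 2 ≤ δ) :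
    u (n + 1) = v (n + 1) := by
  set W := midLevel u n - midLevel v n with hWdef
  have hW : IsGridFun M W := fun j hj => by
    simp [hWdef, hu.isGridFun_midLevel hn j hj, hv.isGridFun_midLevel hn j hj]
  have hWj : ∀ j, u (n + 1) j - v (n + 1) j = 2 * W j := fun j => by
    simp only [hWdef, Pi.sub_apply, midLevel, huv]
    ring
  suffices hW0 : W = 0 by
    funext j
    have := hWj j
    rw [hW0, Pi.zero_apply, mul_zero] at this
    exact sub_eq_zero.mp this
  refine hW.eq_zero_of_energy_nonpos ?_
  set Z := ‖(κ : ℂ) + Complex.I * (ζ : ℂ)‖ with hZ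
  have hQ := le_sum_re_fracLap hW h1 h2 hM hh hυ η
  have hpt : ∀ j ∈ Finset.Ioo (0 : ℤ) M, (((υ : ℂ) + Complex.I * (η : ℂ)) *
        (conj (W j) * fracLap α h M W j)).re ≤ (γ + Z * (3 * (δ / τ)) - 2 / τ) * ‖W j‖ ^ 2 := by
    intro j hj
    rw [Finset.mem_Ioo] at hj
    have eu := hu.scheme n hn j hj.1 hj.2
    have ev := hv.scheme n hn j hj.1 hj.2
    have hcub := norm_cubic_sub_le (x := midLevel u n j) (y := midLevel v n j) (B := δ / τ)
      (by rw [le_div_iff₀ hτ, mul_comm]; exact hU j) (by rw [le_div_iff₀ hτ, mul_comm]; exact hV j)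
    have hfl := fracLap_sub α h M (midLevel u n) (midLevel v n) j
    rw [← hWdef] at hfl
    have hWd : W j = midLevel u n j - midLevel v n j := rfl
    rw [← hWd] at hcub
    set P := ((‖midLevel u n j‖ ^ 2 : ℝ) : ℂ) * midLevel u n j
      - ((‖midLevel v n j‖ ^ 2 : ℝ) : ℂ) * midLevel v n j with hP
    have hdt : (u (n + 1) j - u n j) / (τ : ℂ) - (v (n + 1) j - v n j) / (τ : ℂ)
        = ((2 / τ : ℝ) : ℂ) * W j := by
      rw [huv, ← sub_div, sub_sub_sub_cancel_right, hWj]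
      push_cast
      ring
    have e1 : ((υ : ℂ) + Complex.I * (η : ℂ)) * (conj (W j) * fracLap α h M W j) =
        ((γ - 2 / τ : ℝ) : ℂ) * (W j * conj (W j))
          - conj (W j) * (((κ : ℂ) + Complex.I * (ζ : ℂ)) * P) := by
      rw [hfl, hP, Complex.ofReal_sub]
      linear_combination conj (W j) * eu - conj (W j) * ev - conj (W j) * hdt
        - (γ : ℂ) * conj (W j) * hWd
    rw [Complex.mul_conj, Complex.normSq_eq_norm_sq, ← Complex.ofReal_mul] at e1
    rw [e1, Complex.sub_re, Complex.ofReal_re]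
    have h3 : -(conj (W j) * (((κ : ℂ) + Complex.I * (ζ : ℂ)) * P)).re ≤
        ‖W j‖ * (Z * (3 * (δ / τ) * ‖W j‖)) := by
      refine (neg_le_abs _).trans ((Complex.abs_re_le_norm _).trans ?_)
      rw [norm_mul, norm_mul, Complex.norm_conj]
      gcongr
    linarith
  have hsum := Finset.sum_le_sum hpt
  rw [← Finset.mul_sum, ← hW.energy_eq] at hsum
  have h3 : 0 ≤ υ * (1 / h ^ α * ellip α * incr W 1) := by
    have := ellip_pos h1 h2
    have := incr_nonneg W 1
    positivity
  -- After multiplication by `τ`: the terms `τ * γ ≤ 1` and `3 * Z * δ < 1` together stay below 2.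
  have h4 : γ + Z * (3 * (δ / τ)) - 2 / τ < 0 := by
    have e : γ + Z * (3 * (δ / τ)) - 2 / τ = (τ * γ + 3 * Z * δ - 2) / τ := by
      field_simp
    rw [e]
    refine div_neg_of_neg_of_pos ?_ hτ
    have := mul_le_mul_of_nonneg_left (le_abs_self γ) hτ.le
    linarith
  by_contra! h5
  linarith [mul_neg_of_neg_of_pos h4 h5]

end Scheme

end FGL

/-! ### Choice of constants and induction on the time level -/

theorem mainTheorem3 (α υ η κ ζ γ a b T : ℝ) (u₀ : ℝ → ℂ)
    (hα₁ : 1 < α) (hα₂ : α ≤ 2) (hυ : 0 < υ) (hκ : 0 < κ) (hab : a < b) (hT : 0 < T)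
    (hu₀ : ContinuousOn u₀ (Set.Icc a b)) (C : ℝ) (hC : 0 < C) :
    ∃ τ₀ : ℝ, 0 < τ₀ ∧ ∃ h₀ : ℝ, 0 < h₀ ∧
      ∀ M N : ℕ, 0 < M → 0 < N → ∀ h τ : ℝ, h = (b - a) / M → τ = T / N →
        τ ≤ C * h → τ ≤ τ₀ → h ≤ h₀ →
        ∀ m : ℕ, m ≤ N → ∀ u v : ℕ → ℤ → ℂ,
          FGL.IsSchemeSolution α υ η κ ζ γ a h τ M u₀ m u →
          FGL.IsSchemeSolution α υ η κ ζ γ a h τ M u₀ m v →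
          ∀ n : ℕ, n ≤ m → u n = v n := by
  obtain ⟨B, hB⟩ := isCompact_Icc.exists_bound_of_continuousOn hu₀
  set Z := ‖(κ : ℂ) + Complex.I * (ζ : ℂ)‖ with hZ
  have hZ0 : 0 ≤ Z := norm_nonneg _
  set A := (b - a) * (B ^ 2 + T * (γ ^ 2 / (2 * κ))) with hA
  have hA0 : 0 ≤ A := by
    have : 0 < b - a := sub_pos.mpr hab
    positivity
  set δ := 1 / (3 * Z + 1) with hδ
  have hδ0 : 0 < δ := by positivity
  have hδ1 : 3 * Z * δ < 1 := by
    rw [hδ, mul_one_div, div_lt_one (by positivity)]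
    linarith
  -- `ε` is fixed before `h₀`: it makes the part `A * (ε * C)`, which does not decay with `h`, at
  -- most `δ / 2`. The `+ 1` covers `A = 0`.
  set ε := δ / (2 * (A * C + 1)) with hε
  have hε0 : 0 < ε := by positivity
  have hel := FGL.ellip_pos hα₁ hα₂
  have hAε : A * (ε * C) ≤ δ / 2 := by
    have : A * (ε * C) = δ / 2 * (A * C / (A * C + 1)) := by
      rw [hε]
      field_simp
    rw [this]
    refine mul_le_of_le_one_right (by positivity) ?_
    rw [div_le_one (by positivity)]
    linarith
  obtain ⟨h₀, hh₀, hsmall⟩ : ∃ h₀ : ℝ, 0 < h₀ ∧ ∀ h : ℝ, 0 < h → h ≤ h₀ →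
      A * (ε⁻¹ * (h ^ (α - 1) / (2 * υ * FGL.ellip α))) ≤ δ / 2 := by
    set D := A * (ε⁻¹ * (1 / (2 * υ * FGL.ellip α))) with hD
    have hD0 : 0 ≤ D := by positivity
    have hα : 0 < α - 1 := sub_pos.mpr hα₁
    -- The solution of `(D + 1) * h₀ ^ (α - 1) = δ / 2`.
    refine ⟨(δ / 2 / (D + 1)) ^ (α - 1)⁻¹, by positivity, fun h hh hle => ?_⟩
    have h1 : h ^ (α - 1) ≤ δ / 2 / (D + 1) := by
      have := Real.rpow_le_rpow hh.le hle hα.le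
      rwa [Real.rpow_inv_rpow (by positivity) hα.ne'] at this
    have h2 : A * (ε⁻¹ * (h ^ (α - 1) / (2 * υ * FGL.ellip α))) = D * h ^ (α - 1) := by
      rw [hD]
      ring
    have h3 := (le_div_iff₀ (by positivity)).mp h1
    have h4 : 0 < h ^ (α - 1) := Real.rpow_pos_of_pos hh _
    linarith
  refine ⟨1 / (|γ| + 1), by positivity, h₀, hh₀, ?_⟩
  intro M N hM hN h τ hh hτ hτC hτ₀ hhh₀ m hm u v hu hv
  have hM' : (0 : ℝ) < M := by exact_mod_cast hM
  have hN' : (0 : ℝ) < N := by exact_mod_cast hN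
  have hh0 : 0 < h := by rw [hh]; exact div_pos (sub_pos.mpr hab) hM'
  have hτ0 : 0 < τ := by rw [hτ]; exact div_pos hT hN'
  have hMh : M * h = b - a := by rw [hh, mul_div_cancel₀ _ hM'.ne']
  have hγ : τ * |γ| ≤ 1 := by
    rw [le_div_iff₀ (by positivity)] at hτ₀
    linarith
  have hmT : m * τ ≤ T := by
    have h1 : (m : ℝ) ≤ N := by exact_mod_cast hm
    calc (m : ℝ) * τ ≤ N * τ := by gcongr
      _ = T := by rw [hτ, mul_div_cancel₀ _ hN'.ne']
  have hB' : ∀ x ∈ Set.Icc a (a + M * h), ‖u₀ x‖ ≤ B := by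
    rwa [hMh, add_sub_cancel]
  have hbound : ∀ w : ℕ → ℤ → ℂ, FGL.IsSchemeSolution α υ η κ ζ γ a h τ M u₀ m w →
      ∀ n < m, ∀ k, τ * ‖FGL.midLevel w n k‖ ^ 2 ≤ δ := by
    intro w hw n hn k
    have h1 := hw.mul_norm_midLevel_sq_le hα₁ hα₂ hυ hκ hM hh0 hτ0 hB' hmT hτC hε0 hn k
    rw [hMh, ← hA, mul_add] at h1
    linarith [hsmall h hh0 hhh₀]
  intro n hn
  induction n with
  | zero =>
    funext j
    by_cases hj : 0 < j ∧ j < M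
    · rw [hu.initial j hj.1 hj.2, hv.initial j hj.1 hj.2]
    · rw [hu.boundary 0 hn j (by omega), hv.boundary 0 hn j (by omega)]
  | succ n ih =>
    exact hu.eq_succ hv hα₁ hα₂ hυ hM hh0 hτ0 hδ1 hγ hn (ih (Nat.le_of_succ_le hn))
      (hbound u hu n hn) (hbound v hv n hn)
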